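/- Let $G=(V,E)$ be a finite directed acyclic graph. A function $h:V\to\mathbb R$ is isotonic if $h(u)\le h(v)$ whenever there is a directed path from $u$ to $v$. For $f:V\to\mathbb R$ and positive weights $w:V\to(0,\infty)$, an $L_p$ isotonic regression of $(f,w)$, $1<p<\infty$, is an isotonic $g$ minimizing $\sum_{v\in V}\bigl(w(v)\,|f(v)-g(v)|\bigr)^p$ among isotonic functions, and an $L_\infty$ isotonic regression is an isotonic $g$ minimizing $\max_{v\in V} w(v)\,|f(v)-g(v)|$. Define: * $\mathsf{strict}^{\uparrow\infty}(f,w)$ is the limit, as $p\to\infty$, of the $L_p$ isotonic regressions of $(f,w)$. * For nonempty $S\subseteq V$, $\mathsf{wmean}^{\uparrow\infty}((f,w)|S)$ is the limit, as $p\to\infty$, of the minimizers $x\in\mathbb R$ of $\sum_{v\in S}\bigl(w(v)\,|f(v)-x|\bigr)^p$. * For isotonic $g,h$ write $g\prec h$ if there is $\alpha>0$ with $W_g(\alpha)<W_h(\alpha)$ and $W_g(\beta)=W_h(\beta)$ for all $\beta>\alpha$, where $W_g(\alpha)=\sum\{w(v): w(v)\,|g(v)-f(v)|\ge\alpha\}$.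 $\mathsf{lex}_\infty(f,w)$ is the isotonic $g$ with $g\prec h$ for every isotonic $h\ne g$. * A level set of an isotonic $g$ is a maximal weakly connected set of vertices on which $g$ is constant. Let $\mathcal A$ be an $L_\infty$ isotonic regression operator on $G$, i.e. a map that assigns to every $(f,w)$ an $L_\infty$ isotonic regression $\mathcal A(f,w)$ of $(f,w)$. Call $\mathcal A$ monotonic if for all $w$ and all $f\le g$ (pointwise), $\mathcal A(f,w)\le\mathcal A(g,w)$ pointwise; say that $\mathcal A$ preserves level set trimming if for every $(f,w)$ and every level set $L$ of $\mathcal A(f,w)$, the value of $\mathcal A(f,w)$ on $L$ is $\mathsf{wmean}^{\uparrow\infty}((f,w)|L)$. **Theorem.** If $\mathcal A$ is monotonic and preserves level set trimming, then for every $(f,w)$ the limit $\mathsf{strict}^{\uparrow\infty}(f,w)$ and the regression $\mathsf{lex}_\infty(f,w)$ exist and $\mathcal A(f,w)=\mathsf{strict}^{\uparrow\infty}(f,w)=\mathsf{lex}_\infty(f,w)$. Conversely, if $\mathcal A(f,w)=\mathsf{strict}^{\uparrow\infty}(f,w)$ for every $(f,w)$, then $\mathcal A$ is monotonic and preserves level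 set trimming. So these two properties characterize $\mathsf{strict}^{\uparrow\infty}$ among $L_\infty$ isotonic regression operators. -/

import Mathlib

open Filter Topology

namespace IsoReg

variable {V : Type*}

/-- The digraph has no directed cycle. -/
def Acyclic (G : Digraph V) : Prop :=
  ∀ v, ¬ Relation.TransGen G.Adj v v

/-- `h` is isotonic on `G`: if there is a path from `u` to `v` then `h u ≤ h v`. -/
def Isotonic (G : Digraph V) (h : V → ℝ) : Prop :=
  ∀ u v, Relation.TransGen G.Adj u v → h u ≤ h v

/-- `S` is a level set of `g`: a maximal weakly connected set of vertices on which `g` is constant.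
(`SimpleGraph.Connected` includes nonemptiness.) -/
def IsLevelSet (G : Digraph V) (g : V → ℝ) (S : Set V) : Prop :=
  Maximal (fun T : Set V =>
    (G.toSimpleGraphInclusive.induce T).Connected ∧ ∀ u ∈ T, ∀ v ∈ T, g u = g v) S

/-- The weighted `L_p` error, `0 < p < ∞`, of `g` as an approximation of `f` on the vertices in `S`
(without the `p`-th root): the sum of the `p`-th powers of the weighted errors. -/
noncomputable def lpError (p : ℝ) (f w : V → ℝ) (S : Finset V) (g : V → ℝ) : ℝ :=
  ∑ v ∈ S, (w v * |f v - g v|) ^ p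

/-- The weighted `L_∞` error of `g` as an approximation of `f`: the maximal weighted error.
(`V` is finite wherever this is used; the value is `0` if `V` is empty.) -/
noncomputable def linfError (f w : V → ℝ) (g : V → ℝ) : ℝ :=
  ⨆ v, w v * |f v - g v|

/-- `g` is an `L_p` isotonic regression of `(f, w)`, `0 < p < ∞`. -/
def IsLpRegression [Fintype V] (G : Digraph V) (p : ℝ) (f w g : V → ℝ) : Prop :=
  Isotonic G g ∧
    ∀ h, Isotonic G h → lpError p f w Finset.univ g ≤ lpError p f w Finset.univ h

/-- `g` is an `L_∞` isotonic regression of `(f, w)`. -/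
def IsLinfRegression (G : Digraph V) (f w g : V → ℝ) : Prop :=
  Isotonic G g ∧ ∀ h, Isotonic G h → linfError f w g ≤ linfError f w h

/-- `x` is a weighted `L_p` mean of `(f, w)` restricted to `S`, `0 < p < ∞`. -/
def IsWMean (p : ℝ) (f w : V → ℝ) (S : Finset V) (x : ℝ) : Prop :=
  ∀ y : ℝ, lpError p f w S (fun _ => x) ≤ lpError p f w S (fun _ => y)

/-- `c` is the limit, as `p ↗ ∞`, of the weighted `L_p` means of `(f, w)` restricted to `S`. -/
def IsWMeanUpInf (f w : V → ℝ) (S : Finset V) (c : ℝ) : Prop :=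
  ∃ m : ℝ → ℝ, (∀ p, 1 < p → IsWMean p f w S (m p)) ∧ Tendsto m atTop (𝓝 c)

/-- `g` is the strict `L_∞` isotonic regression of `(f, w)`: the limit, as `p ↗ ∞`, of the `L_p`
isotonic regressions of `(f, w)`. -/
def IsStrictUpInf [Fintype V] (G : Digraph V) (f w g : V → ℝ) : Prop :=
  ∃ r : ℝ → V → ℝ, (∀ p, 1 < p → IsLpRegression G p f w (r p)) ∧ Tendsto r atTop (𝓝 g)

/-- The total weight of the vertices where the weighted error of `g` is at least `α`. -/
noncomputable def weightAbove [Fintype V] (f w g : V → ℝ) (α : ℝ) : ℝ :=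
  ∑ v with α ≤ w v * |g v - f v|, w v

/-- `g` strictly precedes `h` in the lexical ordering of the errors in approximating `(f, w)`. -/
def LexLT [Fintype V] (f w g h : V → ℝ) : Prop :=
  ∃ α : ℝ, 0 < α ∧ weightAbove f w g α < weightAbove f w h α ∧
    ∀ β, α < β → weightAbove f w g β = weightAbove f w h β

/-- `g` is the `lex_∞` isotonic regression of `(f, w)`: the isotonic function that strictly precedes
every other isotonic function in the lexical ordering. -/
def IsLexInf [Fintype V] (G : Digraph V) (f w g : V → ℝ) : Prop :=
  Isotonic G g ∧ ∀ h, Isotonic G h → h ≠ g → LexLT f w g h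

/-- `A`, which maps the data `f` and the positive weights `w` to a function on the vertices, is an
`L_∞` isotonic regression operator on `G`. -/
def IsLinfOperator (G : Digraph V) (A : (V → ℝ) → (V → ℝ) → V → ℝ) : Prop :=
  ∀ f w : V → ℝ, (∀ v, 0 < w v) → IsLinfRegression G f w (A f w)

/-- `A` is monotonic in the data, for every choice of positive weights. -/
def IsMonotonic (A : (V → ℝ) → (V → ℝ) → V → ℝ) : Prop :=
  ∀ w : V → ℝ, (∀ v, 0 < w v) → ∀ f g : V → ℝ, f ≤ g → A f w ≤ A g w

/-- `A` preserves level set trimming on `G`: on every level set `L` of `A f w` the regression value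
is the limit, as `p ↗ ∞`, of the weighted `L_p` means of `(f, w)` restricted to `L`. -/
def PreservesLevelSetTrimming (G : Digraph V) (A : (V → ℝ) → (V → ℝ) → V → ℝ) : Prop :=
  ∀ f w : V → ℝ, (∀ v, 0 < w v) → ∀ L : Finset V, IsLevelSet G (A f w) (L : Set V) →
    ∀ v ∈ L, IsWMeanUpInf f w L (A f w v)

end IsoReg

/-!
As `p → ∞` the first-order conditions of the `L_p` regressions, for perturbations that lower the
regression on an upper level set or raise it on a lower one, turn into conditions on the largest
weighted errors. They force every cluster point `g` to satisfy a min–max formula: `g v` is the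
maximum over upsets `U ∋ v` of the minimum over downsets `L ∋ v` of the weighted `L_∞` mean of `f`
on `U ∩ L`, and also the minimum of the maximum. Intersecting an upset optimal for one solution with
a downset optimal for another gives a comparison principle. Hence the formula has a unique
solution, which is monotone in `f`, and by compactness the `L_p` regressions converge to it. Taking
`L` to be the union of a level set and all smaller level sets gives level set trimming, and taking
for `L` a lower level set of a competing isotonic function gives lexicographic minimality.

For a monotonic operator, raising the data far up outside a downset `L` can only raise the result,
and it makes the values on `L` smaller than all others. Every level set that meets `L` then lies in
`L`, and trimming gives one of the inequalities of the formula; the other one is dual. The trimming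
values themselves are `L_p` regressions on the complete digraph, whose only nonempty upset or
downset is the whole vertex set.
-/

namespace IsoReg

section PowerSums

/-- The odd extension of `y ↦ y ^ (p - 1)` from `[0, ∞)` to `ℝ`, which is the derivative of
`y ↦ |y| ^ p / p`. -/
noncomputable def signedPow (p y : ℝ) : ℝ := |y| ^ (p - 2) * y

lemma signedPow_neg (p y : ℝ) : signedPow p (-y) = -signedPow p y := by
  simp [signedPow]

lemma signedPow_of_pos (p : ℝ) {y : ℝ} (hy : 0 < y) : signedPow p y = y ^ (p - 1) := by
  rw [signedPow, abs_of_pos hy, ← Real.rpow_add_one hy.ne']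
  congr 1
  ring

lemma signedPow_le {p y b : ℝ} (hp : 1 < p) (hb : 0 < b) (h : y ≤ b) :
    signedPow p y ≤ b ^ (p - 1) := by
  rcases lt_or_ge 0 y with hy | hy
  · rw [signedPow_of_pos p hy]
    exact Real.rpow_le_rpow hy.le h (by linarith)
  · exact (mul_nonpos_of_nonneg_of_nonpos (by positivity) hy).trans (by positivity)

lemma signedPow_le_neg {p y a : ℝ} (hp : 1 < p) (ha : 0 < a) (h : y ≤ -a) :
    signedPow p y ≤ -a ^ (p - 1) := by
  have hy : 0 < -y := by linarith
  rw [← neg_neg y, signedPow_neg, signedPow_of_pos p hy, neg_le_neg_iff]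
  exact Real.rpow_le_rpow ha.le (by linarith) (by linarith)

lemma eventually_mul_rpow_lt_mul_rpow {a b c : ℝ} (C : ℝ) (hb : 0 < b) (hba : b < a)
    (hc : 0 < c) : ∀ᶠ p : ℝ in atTop, C * b ^ (p - 1) < c * a ^ (p - 1) := by
  have ha : 0 < a := hb.trans hba
  have hratio : Tendsto (fun p : ℝ => C * (b / a) ^ (p - 1)) atTop (𝓝 (C * 0)) :=
    ((tendsto_rpow_atTop_of_base_lt_one (b / a) (by linarith [div_pos hb ha])
      ((div_lt_one ha).2 hba)).comp (tendsto_atTop_add_const_right _ (-1) tendsto_id)).const_mul C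
  filter_upwards [hratio.eventually_lt_const (u := c) (by rwa [mul_zero])] with p hp
  rwa [Real.div_rpow hb.le ha.le, ← mul_div_assoc, div_lt_iff₀ (by positivity)] at hp

lemma sum_mul_signedPow_neg {ι : Type*} {S : Finset ι} {w y : ι → ℝ} (hw : ∀ i ∈ S, 0 ≤ w i)
    {p a b : ℝ} (hp : 1 < p) (ha : 0 < a) (hb : 0 < b) (hy : ∀ i ∈ S, y i ≤ b) {j : ι}
    (hj : j ∈ S) (hyj : y j ≤ -a) (hab : (∑ i ∈ S, w i) * b ^ (p - 1) < w j * a ^ (p - 1)) :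
    ∑ i ∈ S, w i * signedPow p (y i) < 0 := by
  classical
  have hterm : w j * signedPow p (y j) ≤ w j * -a ^ (p - 1) :=
    mul_le_mul_of_nonneg_left (signedPow_le_neg hp ha hyj) (hw j hj)
  have hrest : ∑ i ∈ S.erase j, w i * signedPow p (y i) ≤ (∑ i ∈ S, w i) * b ^ (p - 1) := by
    calc ∑ i ∈ S.erase j, w i * signedPow p (y i)
        ≤ ∑ i ∈ S.erase j, w i * b ^ (p - 1) := Finset.sum_le_sum fun i hi =>
          have hi := Finset.mem_of_mem_erase hi
          mul_le_mul_of_nonneg_left (signedPow_le hp hb (hy i hi)) (hw i hi)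
      _ ≤ ∑ i ∈ S, w i * b ^ (p - 1) :=
          Finset.sum_le_sum_of_subset_of_nonneg (Finset.erase_subset j S) fun i hi _ =>
            mul_nonneg (hw i hi) (Real.rpow_nonneg hb.le _)
      _ = (∑ i ∈ S, w i) * b ^ (p - 1) := (Finset.sum_mul ..).symm
  rw [← Finset.add_sum_erase S _ hj]
  linarith

lemma exists_neg_le_of_frequently_sum_signedPow_nonneg {ι : Type*} {S : Finset ι} {w : ι → ℝ}
    (hw : ∀ i ∈ S, 0 < w i) {l : Filter ℝ} (hl : l ≤ atTop) {y : ℝ → ι → ℝ} {z : ι → ℝ}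
    (hy : Tendsto y l (𝓝 z)) (h : ∃ᶠ p in l, 0 ≤ ∑ i ∈ S, w i * signedPow p (y p i)) {j : ι}
    (hj : j ∈ S) : ∃ i ∈ S, -z j ≤ z i := by
  by_contra! hlt
  have hz : 0 < -z j := by linarith [hlt j hj]
  obtain ⟨b, ⟨hb, hzb⟩, hbz⟩ : ∃ b, (0 < b ∧ ∀ i ∈ S, z i < b) ∧ b < -z j := by
    have hnhds : ∀ᶠ b in 𝓝 (-z j), 0 < b ∧ ∀ i ∈ S, z i < b :=
      (eventually_gt_nhds hz).and
        (S.eventually_all.2 fun i hi => eventually_gt_nhds (hlt i hi))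
    exact ((hnhds.filter_mono nhdsWithin_le_nhds).and self_mem_nhdsWithin).exists
      (f := 𝓝[<] (-z j))
  obtain ⟨a, hba, haz⟩ := exists_between hbz
  rw [tendsto_pi_nhds] at hy
  have hyb : ∀ᶠ p in l, ∀ i ∈ S, y p i < b :=
    S.eventually_all.2 fun i hi => (hy i).eventually_lt_const (hzb i hi)
  have hya : ∀ᶠ p in l, y p j < -a := (hy j).eventually_lt_const (by linarith)
  obtain ⟨p, hsum, hyb, hya, hab, hp⟩ := (h.and_eventually (hyb.and (hya.and
    ((eventually_mul_rpow_lt_mul_rpow (∑ i ∈ S, w i) hb hba (hw j hj)).and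
      (eventually_gt_atTop 1) |>.filter_mono hl)))).exists
  exact hsum.not_gt (sum_mul_signedPow_neg (fun i hi => (hw i hi).le) hp (hb.trans hba) hb
    (fun i hi => (hyb i hi).le) hj hya.le hab)

lemma sum_rpow_le_rpow_sum {ι : Type*} (S : Finset ι) {a : ι → ℝ} (ha : ∀ i ∈ S, 0 ≤ a i)
    {p : ℝ} (hp : 1 ≤ p) : ∑ i ∈ S, a i ^ p ≤ (∑ i ∈ S, a i) ^ p := by
  classical
  induction S using Finset.induction_on with
  | empty => simpa using Real.zero_rpow_nonneg p
  | insert i S hi ih =>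
    rw [Finset.forall_mem_insert] at ha
    rw [Finset.sum_insert hi, Finset.sum_insert hi]
    exact (add_le_add_right (ih ha.2) _).trans
      (Real.add_rpow_le_rpow_add ha.1 (Finset.sum_nonneg ha.2) hp)

end PowerSums

section Digraphs

variable {V : Type*} {G : Digraph V} {f w g h : V → ℝ}

/-- The digraph with all edges reversed. Passing to it and negating all functions exchanges the
two sides of every notion below. -/
def reverse (G : Digraph V) : Digraph V := ⟨flip G.Adj⟩

lemma isotonic_iff_adj : Isotonic G h ↔ ∀ u v, G.Adj u v → h u ≤ h v := by
  refine ⟨fun hh u v huv => hh u v (.single huv), fun hh u v huv => ?_⟩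
  induction huv with
  | single huv => exact hh _ _ huv
  | tail _ huv ih => exact ih.trans (hh _ _ huv)

lemma Isotonic.reverse (hh : Isotonic G h) : Isotonic (reverse G) (-h) :=
  isotonic_iff_adj.2 fun u v huv => neg_le_neg (isotonic_iff_adj.1 hh v u huv)

lemma isotonic_const (G : Digraph V) (c : ℝ) : Isotonic G fun _ => c := fun _ _ _ => le_rfl

lemma isotonic_top_iff [Nonempty V] : Isotonic (⊤ : Digraph V) h ↔ ∃ c, h = fun _ => c := by
  refine ⟨fun hh => ?_, ?_⟩
  · obtain ⟨v⟩ := ‹Nonempty V›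
    rw [isotonic_iff_adj] at hh
    exact ⟨h v, funext fun u => (hh u v trivial).antisymm (hh v u trivial)⟩
  · rintro ⟨c, rfl⟩
    exact isotonic_const ⊤ c

lemma isClosed_setOf_isotonic (G : Digraph V) : IsClosed {h | Isotonic G h} := by
  simp only [Isotonic, Set.ofPred_forall]
  exact isClosed_iInter fun u => isClosed_iInter fun v => isClosed_iInter fun _ =>
    isClosed_le (continuous_apply u) (continuous_apply v)

/-- A set of vertices that contains every predecessor of each of its vertices. -/
def IsDownset (G : Digraph V) (L : Set V) : Prop := ∀ u v, G.Adj u v → v ∈ L → u ∈ L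

/-- A set of vertices that contains every successor of each of its vertices. -/
def IsUpset (G : Digraph V) (U : Set V) : Prop := IsDownset (reverse G) U

lemma Isotonic.isDownset_le (hh : Isotonic G h) (c : ℝ) : IsDownset G {x | h x ≤ c} :=
  fun u v huv hv => (isotonic_iff_adj.1 hh u v huv).trans hv

lemma Isotonic.isUpset_ge (hh : Isotonic G h) (c : ℝ) : IsUpset G {x | c ≤ h x} :=
  fun u v huv hv => le_trans (α := ℝ) hv (isotonic_iff_adj.1 hh v u huv)

lemma lpError_neg (p : ℝ) (f w : V → ℝ) (S : Finset V) (g : V → ℝ) :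
    lpError p (-f) w S (-g) = lpError p f w S g := by
  simp only [lpError, Pi.neg_apply, neg_sub_neg, abs_sub_comm]

lemma linfError_neg (f w g : V → ℝ) : linfError (-f) w (-g) = linfError f w g := by
  simp only [linfError, Pi.neg_apply, neg_sub_neg, abs_sub_comm]

lemma IsLpRegression.reverse [Fintype V] {p : ℝ} (hg : IsLpRegression G p f w g) :
    IsLpRegression (reverse G) p (-f) w (-g) := by
  refine ⟨hg.1.reverse, fun h hh => ?_⟩
  rw [lpError_neg, ← neg_neg h, lpError_neg]
  exact hg.2 _ hh.reverse

lemma IsLinfRegression.reverse (hg : IsLinfRegression G f w g) :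
    IsLinfRegression (reverse G) (-f) w (-g) := by
  refine ⟨hg.1.reverse, fun h hh => ?_⟩
  rw [linfError_neg, ← neg_neg h, linfError_neg]
  exact hg.2 _ hh.reverse

end Digraphs

section LpRegression

variable {V : Type*} {G : Digraph V} {p : ℝ} {f w g : V → ℝ}

lemma hasDerivAt_mul_abs_sub_rpow {p w : ℝ} (hp : 1 < p) (hw : 0 ≤ w) (f x : ℝ) :
    HasDerivAt (fun t => (w * |f - (x - t)|) ^ p) (p * (w * signedPow p (w * (f - x)))) 0 := by
  have hinner : HasDerivAt (fun t => w * (f - (x - t))) w 0 := by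
    simpa using (((hasDerivAt_id (0 : ℝ)).const_sub x).const_sub f).const_mul w
  have houter := (hasDerivAt_abs_rpow (w * (f - (x - 0))) hp).comp (0 : ℝ) hinner
  simp only [Function.comp_def, abs_mul, abs_of_nonneg hw] at houter
  refine houter.congr_deriv ?_
  simp only [signedPow, sub_zero, abs_mul, abs_of_nonneg hw]
  ring

lemma hasDerivAt_lpError_sub_indicator (hp : 1 < p) (hw : ∀ v, 0 ≤ w v) {S T : Finset V}
    (hTS : T ⊆ S) (f g : V → ℝ) :
    HasDerivAt (fun t => lpError p f w S (g - (T : Set V).indicator fun _ => t))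
      (p * ∑ v ∈ T, w v * signedPow p (w v * (f v - g v))) 0 := by
  classical
  rw [Finset.mul_sum, ← Finset.sum_indicator_subset _ hTS]
  refine HasDerivAt.fun_sum fun v _ => ?_
  by_cases hv : v ∈ (T : Set V)
  · simp only [Pi.sub_apply, Set.indicator_of_mem hv]
    exact hasDerivAt_mul_abs_sub_rpow hp (hw v) (f v) (g v)
  · simp only [Pi.sub_apply, Set.indicator_of_notMem hv]
    exact hasDerivAt_const _ _

lemma eventually_isotonic_sub_indicator [Finite V] (hg : Isotonic G g) {T : Set V}
    (hT : ∀ a b, G.Adj a b → b ∈ T → a ∉ T → g a < g b) :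
    ∀ᶠ t in 𝓝[>] (0 : ℝ), Isotonic G (g - T.indicator fun _ => t) := by
  have hgap : ∀ᶠ t in 𝓝[>] (0 : ℝ), ∀ a b, G.Adj a b → b ∈ T → a ∉ T → t < g b - g a := by
    simp only [eventually_all]
    exact fun a b hab hb ha => mem_nhdsWithin_of_mem_nhds
      (eventually_lt_nhds (sub_pos.2 (hT a b hab hb ha)))
  filter_upwards [hgap, self_mem_nhdsWithin] with t ht (ht0 : 0 < t)
  refine isotonic_iff_adj.2 fun a b hab => ?_
  have hle := isotonic_iff_adj.1 hg a b hab
  by_cases ha : a ∈ T <;> by_cases hb : b ∈ T <;> simp only [Pi.sub_apply, ha, hb,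
    Set.indicator_of_mem, Set.indicator_of_notMem, not_false_eq_true]
  · linarith
  · linarith
  · linarith [ht a b hab hb ha]
  · linarith

lemma IsLpRegression.sum_signedPow_nonneg [Fintype V] (hp : 1 < p) (hw : ∀ v, 0 ≤ w v)
    (hg : IsLpRegression G p f w g) {T : Finset V}
    (hT : ∀ a b, G.Adj a b → b ∈ T → a ∉ T → g a < g b) :
    0 ≤ ∑ v ∈ T, w v * signedPow p (w v * (f v - g v)) := by
  have hmin : IsLocalMinOn
      (fun t => lpError p f w Finset.univ (g - (T : Set V).indicator fun _ => t))
      (Set.Ioi 0) 0 := by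
    filter_upwards [eventually_isotonic_sub_indicator hg.1 (T := (T : Set V)) hT] with t ht
    simpa [Pi.sub_def] using hg.2 _ ht
  have hderiv := hmin.hasFDerivWithinAt_nonneg
    (hasDerivAt_lpError_sub_indicator hp hw (Finset.subset_univ T) f g).hasDerivWithinAt
    (one_mem_posTangentConeAt_iff_frequently.2 (Eventually.frequently self_mem_nhdsWithin))
  simp only [ContinuousLinearMap.toSpanSingleton_apply, one_smul] at hderiv
  exact nonneg_of_mul_nonneg_right hderiv (by linarith)

lemma continuous_lpError (hp : 0 ≤ p) (f w : V → ℝ) (S : Finset V) :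
    Continuous (lpError p f w S) :=
  continuous_finsetSum _ fun _ _ => Continuous.rpow_const (by fun_prop) fun _ => Or.inr hp

/-- A box that contains, for every `p ≥ 1`, all functions whose `L_p` error is at most that of the
zero function. -/
noncomputable def errorBox [Fintype V] (f w : V → ℝ) : Set (V → ℝ) :=
  Set.univ.pi fun v => Metric.closedBall (f v) ((∑ u, w u * |f u|) / w v)

lemma isCompact_errorBox [Fintype V] (f w : V → ℝ) : IsCompact (errorBox f w) :=
  isCompact_univ_pi fun _ => isCompact_closedBall _ _

lemma mem_errorBox_of_lpError_le [Fintype V] (hp : 1 ≤ p) (hw : ∀ v, 0 < w v)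
    (h : lpError p f w Finset.univ g ≤ lpError p f w Finset.univ 0) : g ∈ errorBox f w := by
  intro v _
  have hnonneg : ∀ u x, 0 ≤ w u * |x| := fun u x => mul_nonneg (hw u).le (abs_nonneg x)
  have hpow : (w v * |f v - g v|) ^ p ≤ (∑ u, w u * |f u|) ^ p := by
    calc (w v * |f v - g v|) ^ p
        ≤ lpError p f w Finset.univ g :=
          Finset.single_le_sum (f := fun u => (w u * |f u - g u|) ^ p)
            (fun u _ => Real.rpow_nonneg (hnonneg u _) p) (Finset.mem_univ v)
      _ ≤ ∑ u, (w u * |f u|) ^ p := by simpa [lpError] using h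
      _ ≤ (∑ u, w u * |f u|) ^ p := sum_rpow_le_rpow_sum _ (fun u _ => hnonneg u _) hp
  have hle := (Real.rpow_le_rpow_iff (hnonneg v _)
    (Finset.sum_nonneg fun u _ => hnonneg u (f u)) (by linarith)).1 hpow
  rwa [Metric.mem_closedBall, dist_comm, Real.dist_eq, le_div_iff₀' (hw v)]

lemma IsLpRegression.mem_errorBox [Fintype V] (hp : 1 ≤ p) (hw : ∀ v, 0 < w v)
    (hg : IsLpRegression G p f w g) : g ∈ errorBox f w :=
  mem_errorBox_of_lpError_le hp hw (hg.2 0 (isotonic_const G 0))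

lemma exists_isLpRegression [Fintype V] (G : Digraph V) (hp : 1 ≤ p) (f : V → ℝ)
    (hw : ∀ v, 0 < w v) : ∃ g, IsLpRegression G p f w g := by
  refine (continuous_lpError (by linarith) f w Finset.univ).continuousOn.exists_isMinOn'
    (isClosed_setOf_isotonic G) (isotonic_const G 0) (mem_inf_of_left ?_)
  filter_upwards [(isCompact_errorBox f w).compl_mem_cocompact] with g hg
  by_contra! hlt
  exact hg (mem_errorBox_of_lpError_le hp hw hlt.le)

end LpRegression

section Submeans

variable {V : Type*} {f f' w : V → ℝ} {S : Set V} {c c' : ℝ}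

/-- `c` is at most the weighted `L_∞` mean of `f` on `S`: on `S` the largest weighted error of `c`
from above is at most its largest weighted error from below. -/
def IsSubmean (f w : V → ℝ) (S : Set V) (c : ℝ) : Prop :=
  ∀ v ∈ S, ∃ u ∈ S, w v * (c - f v) ≤ w u * (f u - c)

/-- `c` is at least the weighted `L_∞` mean of `f` on `S`. -/
def IsSupermean (f w : V → ℝ) (S : Set V) (c : ℝ) : Prop := IsSubmean (-f) w S (-c)

lemma IsSubmean.of_le (hw : ∀ v, 0 ≤ w v) (h : IsSubmean f w S c) (hc : c' ≤ c) :
    IsSubmean f w S c' := by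
  intro v hv
  obtain ⟨u, hu, hvu⟩ := h v hv
  refine ⟨u, hu, ?_⟩
  calc w v * (c' - f v) ≤ w v * (c - f v) := by gcongr; exact hw v
    _ ≤ w u * (f u - c) := hvu
    _ ≤ w u * (f u - c') := by gcongr; exact hw u

lemma IsSubmean.congr (h : IsSubmean f w S c) (hf : Set.EqOn f f' S) : IsSubmean f' w S c := by
  intro v hv
  obtain ⟨u, hu, hvu⟩ := h v hv
  exact ⟨u, hu, by rwa [← hf hv, ← hf hu]⟩

lemma isSubmean_of_forall_exists_subset
    (h : ∀ v ∈ S, ∃ T ⊆ S, v ∈ T ∧ IsSubmean f w T c) : IsSubmean f w S c := by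
  intro v hv
  obtain ⟨T, hTS, hvT, hT⟩ := h v hv
  obtain ⟨u, hu, hvu⟩ := hT v hvT
  exact ⟨u, hTS hu, hvu⟩

lemma IsSubmean.le_of_isSupermean [Finite V] (h : IsSubmean f w S c)
    (h' : IsSupermean f' w S c') (hw : ∀ v, 0 < w v) (hf : f ≤ f') (hS : S.Nonempty) :
    c ≤ c' := by
  by_contra! hlt
  obtain ⟨v, hv, hmax⟩ := Set.exists_max_image S (fun v => w v * (c' - f' v)) S.toFinite hS
  obtain ⟨u, hu, hvu⟩ := h v hv
  obtain ⟨v', hv', huv'⟩ := h' u hu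
  simp only [Pi.neg_apply, neg_sub_neg] at huv'
  refine lt_irrefl (w v * (c - f v)) ?_
  calc w v * (c - f v) ≤ w u * (f u - c) := hvu
    _ < w u * (f' u - c') := mul_lt_mul_of_pos_left (by linarith [hf u]) (hw u)
    _ ≤ w v' * (c' - f' v') := huv'
    _ ≤ w v * (c' - f' v) := hmax v' hv'
    _ ≤ w v * (c - f v) := mul_le_mul_of_nonneg_left (by linarith [hf v]) (hw v).le

end Submeans

section Saddles

variable {V : Type*} {G : Digraph V} {f f' w g g' h : V → ℝ}

/-- For every `v`, the maximum over upsets `U ∋ v` of the minimum over downsets `L ∋ v` of the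
weighted `L_∞` means on `U ∩ L` is at least `g v`, and this is witnessed by an upset on which `g`
is at least `g v`. -/
def IsLowerSaddle (G : Digraph V) (f w g : V → ℝ) : Prop :=
  ∀ v, ∃ U, v ∈ U ∧ IsUpset G U ∧ (∀ x ∈ U, g v ≤ g x) ∧
    ∀ L, v ∈ L → IsDownset G L → IsSubmean f w (U ∩ L) (g v)

/-- The dual of `IsLowerSaddle`: every `g v` is at least the minimum over downsets `L ∋ v` of the
maximum over upsets `U ∋ v` of the weighted `L_∞` means on `U ∩ L`. -/
def IsUpperSaddle (G : Digraph V) (f w g : V → ℝ) : Prop :=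
  IsLowerSaddle (reverse G) (-f) w (-g)

/-- The values of `g` are given by the min–max formula over upsets and downsets of which
`IsLowerSaddle` and `IsUpperSaddle` express the two inequalities. -/
def IsSaddle (G : Digraph V) (f w g : V → ℝ) : Prop :=
  IsLowerSaddle G f w g ∧ IsUpperSaddle G f w g

lemma IsSaddle.reverse (hg : IsSaddle G f w g) : IsSaddle (reverse G) (-f) w (-g) := by
  refine ⟨hg.2, ?_⟩
  rw [IsUpperSaddle, neg_neg, neg_neg]
  exact hg.1

lemma IsLowerSaddle.isotonic (hg : IsLowerSaddle G f w g) : Isotonic G g := by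
  refine isotonic_iff_adj.2 fun u v huv => ?_
  obtain ⟨U, huU, hU, hge, -⟩ := hg u
  exact hge v (hU v u huv huU)

lemma IsLowerSaddle.le_of_isUpperSaddle [Finite V] (hw : ∀ v, 0 < w v) (hf : f ≤ f')
    (hg : IsLowerSaddle G f w g) (hg' : IsUpperSaddle G f' w g') : g ≤ g' := by
  intro v
  obtain ⟨U, hvU, hU, -, hsub⟩ := hg v
  obtain ⟨L, hvL, hL, -, hsuper⟩ := hg' v
  have hsuper_UL : IsSupermean f' w (U ∩ L) (g' v) := by
    rw [Set.inter_comm]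
    exact hsuper U hvU hU
  exact (hsub L hvL hL).le_of_isSupermean hsuper_UL hw hf ⟨v, hvU, hvL⟩

lemma IsSaddle.eq [Finite V] (hw : ∀ v, 0 < w v) (hg : IsSaddle G f w g)
    (hg' : IsSaddle G f w g') : g = g' :=
  (hg.1.le_of_isUpperSaddle hw le_rfl hg'.2).antisymm (hg'.1.le_of_isUpperSaddle hw le_rfl hg.2)

lemma IsLevelSet.mem_of_adj {K : Set V} (hK : IsLevelSet G g K) {a b : V} (ha : a ∈ K)
    (hab : G.Adj a b ∨ G.Adj b a) (hg : g a = g b) : b ∈ K := by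
  rcases eq_or_ne a b with rfl | hne
  · exact ha
  have hadj : G.toSimpleGraphInclusive.Adj a b := (SimpleGraph.fromRel_adj _ _ _).2 ⟨hne, hab⟩
  have hval : ∀ x ∈ K ∪ {a, b}, g x = g a := by
    rintro x (hx | rfl | rfl)
    · exact hK.prop.2 x hx a ha
    · rfl
    · exact hg.symm
  refine hK.2 (y := K ∪ {a, b}) ⟨?_, fun u hu v hv => (hval u hu).trans (hval v hv).symm⟩
    Set.subset_union_left (Or.inr (Or.inr rfl))
  exact SimpleGraph.induce_union_connected hK.prop.1.preconnected
    (SimpleGraph.induce_pair_connected_of_adj hadj).preconnected ⟨a, ha, Or.inl rfl⟩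

lemma IsLowerSaddle.isSubmean_levelSet (hg : IsLowerSaddle G f w g) {K : Set V}
    (hK : IsLevelSet G g K) {v : V} (hv : v ∈ K) : IsSubmean f w K (g v) := by
  intro x hx
  have hgK : ∀ {y}, y ∈ K → g y = g v := fun hy => hK.prop.2 _ hy v hv
  have hL : IsDownset G ({y | g y < g v} ∪ K) := by
    intro a b hab hb
    have hle := isotonic_iff_adj.1 hg.isotonic a b hab
    rcases hb with hb | hb
    · exact Or.inl (hle.trans_lt hb)
    · rw [← hgK hb]
      exact hle.lt_or_eq.imp_right fun heq => hK.mem_of_adj hb (Or.inr hab) heq.symm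
  obtain ⟨U, hxU, -, hge, hsub⟩ := hg x
  obtain ⟨u, ⟨huU, huL⟩, hxu⟩ := hsub ({y | g y < g v} ∪ K) (Or.inr hx) hL x ⟨hxU, Or.inr hx⟩
  rw [hgK hx] at hge hxu
  exact ⟨u, huL.resolve_left (hge u huU).not_gt, hxu⟩

lemma lexLT_of_forall_exists_error_lt [Fintype V] (hw : ∀ v, 0 < w v) (hne : h ≠ g)
    (hlt : ∀ v, g v ≠ h v → ∃ u, g u ≠ h u ∧ w v * |g v - f v| < w u * |h u - f u|) :
    LexLT f w g h := by
  obtain ⟨v₀, hv₀⟩ := Function.ne_iff.1 hne.symm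
  obtain ⟨m, hm, hmax⟩ := Set.exists_max_image {v | g v ≠ h v} (fun v => w v * |h v - f v|)
    (Set.toFinite _) ⟨v₀, hv₀⟩
  have hgm : ∀ v, g v ≠ h v → w v * |g v - f v| < w m * |h m - f m| := fun v hv =>
    let ⟨u, hu, hvu⟩ := hlt v hv
    hvu.trans_le (hmax u hu)
  have hpos : 0 < w m * |h m - f m| :=
    (mul_nonneg (hw m).le (abs_nonneg _)).trans_lt (hgm m hm)
  refine ⟨w m * |h m - f m|, hpos, ?_, fun β hβ => ?_⟩
  · refine Finset.sum_lt_sum_of_subset (i := m) (fun v hv => ?_) (by simp) (by simpa using hgm m hm)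
      (hw m) fun v _ _ => (hw v).le
    simp only [Finset.mem_filter, Finset.mem_univ, true_and] at hv ⊢
    by_cases hgh : g v = h v
    · rwa [← hgh]
    · exact absurd hv (hgm v hgh).not_ge
  · refine Finset.sum_congr (Finset.filter_congr fun v _ => ?_) fun _ _ => rfl
    by_cases hgh : g v = h v
    · rw [hgh]
    · exact iff_of_false ((hgm v hgh).trans hβ).not_ge ((hmax v hgh).trans_lt hβ).not_ge

lemma IsLowerSaddle.exists_error_lt (hw : ∀ v, 0 < w v) (hg : IsLowerSaddle G f w g)
    (hh : Isotonic G h) {v : V} (hv : g v ≠ h v) (hvf : f v ≤ g v) :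
    ∃ u, g u ≠ h u ∧ w v * |g v - f v| < w u * |h u - f u| := by
  rw [abs_of_nonneg (sub_nonneg.2 hvf)]
  rcases hv.lt_or_gt with hgh | hhg
  · refine ⟨v, hv, mul_lt_mul_of_pos_left ?_ (hw v)⟩
    exact (sub_lt_sub_right hgh _).trans_le (le_abs_self _)
  · obtain ⟨U, hvU, -, hge, hsub⟩ := hg v
    obtain ⟨u, ⟨huU, huL⟩, hvu⟩ :=
      hsub {x | h x ≤ h v} (le_refl (h v)) (hh.isDownset_le _) v ⟨hvU, le_refl (h v)⟩
    have hhu : h u < g v := lt_of_le_of_lt huL hhg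
    refine ⟨u, (hhu.trans_le (hge u huU)).ne', ?_⟩
    calc w v * (g v - f v) ≤ w u * (f u - g v) := hvu
      _ < w u * (f u - h u) := mul_lt_mul_of_pos_left (sub_lt_sub_left hhu _) (hw u)
      _ ≤ w u * |h u - f u| := by
        rw [abs_sub_comm]
        exact mul_le_mul_of_nonneg_left (le_abs_self _) (hw u).le

lemma IsSaddle.lexLT [Fintype V] (hw : ∀ v, 0 < w v) (hg : IsSaddle G f w g)
    (hh : Isotonic G h) (hne : h ≠ g) : LexLT f w g h := by
  refine lexLT_of_forall_exists_error_lt hw hne fun v hv => ?_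
  rcases le_total (f v) (g v) with hvf | hvf
  · exact hg.1.exists_error_lt hw hh hv hvf
  · simpa only [Pi.neg_apply, neg_sub_neg, abs_sub_comm, ne_eq, neg_inj] using
      hg.2.exists_error_lt hw hh.reverse (v := v) (by simpa using hv) (neg_le_neg hvf)

end Saddles

section StrictRegression

variable {V : Type*} [Fintype V] {G : Digraph V} {f w g : V → ℝ}

lemma IsLpRegression.sum_signedPow_nonneg_of_isDownset {p : ℝ} (hp : 1 < p) (hw : ∀ v, 0 ≤ w v)
    (hg : IsLpRegression G p f w g) {v : V} {L T : Set V} (hL : IsDownset G L)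
    (hT : {x | g v ≤ g x} ∩ L = T) :
    0 ≤ ∑ x ∈ T.toFinite.toFinset, w x * signedPow p (w x * (f x - g x)) := by
  subst hT
  refine hg.sum_signedPow_nonneg hp hw fun a b hab hb ha => ?_
  rw [Set.Finite.mem_toFinset] at ha hb
  exact (not_le.1 fun hva => ha ⟨hva, hL a b hab hb.2⟩).trans_le hb.1

lemma isLowerSaddle_of_mapClusterPt (hw : ∀ v, 0 < w v) {ρ : ℝ → V → ℝ}
    (hρ : ∀ p, 1 < p → IsLpRegression G p f w (ρ p)) (hcluster : MapClusterPt g atTop ρ) :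
    IsLowerSaddle G f w g := by
  obtain ⟨l, hl, hlim⟩ := mapClusterPt_iff_ultrafilter.1 hcluster
  intro v
  -- Pigeonhole: one of the finitely many vertex sets recurs as upper level set for large `p`.
  obtain ⟨U, hU⟩ : ∃ U : Set V, ∃ᶠ p in (l : Filter ℝ), {x | ρ p v ≤ ρ p x} = U :=
    Filter.frequently_exists.1 (Frequently.of_forall fun p => ⟨_, rfl⟩)
  have hregr : ∃ᶠ p in (l : Filter ℝ), {x | ρ p v ≤ ρ p x} = U ∧ 1 < p :=
    hU.and_eventually (hl (eventually_gt_atTop 1))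
  obtain ⟨q, rfl, hq⟩ := hregr.exists
  have hge : ∀ x, ρ q v ≤ ρ q x → g v ≤ g x := fun x hx =>
    le_of_tendsto_of_tendsto_of_frequently (tendsto_pi_nhds.1 hlim v) (tendsto_pi_nhds.1 hlim x)
      (hU.mono fun p hp => hp.symm.subset hx)
  refine ⟨{x | ρ q v ≤ ρ q x}, le_refl (ρ q v), (hρ q hq).1.isUpset_ge _, hge,
    fun L _ hL x hx => ?_⟩
  have herr : Tendsto (fun p y => w y * (f y - ρ p y)) l (𝓝 fun y => w y * (f y - g y)) :=
    tendsto_const_nhds.mul (tendsto_const_nhds.sub hlim)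
  obtain ⟨u, hu, hxu⟩ := exists_neg_le_of_frequently_sum_signedPow_nonneg (fun y _ => hw y) hl herr
    (hregr.mono fun p ⟨hpU, hp⟩ => (hρ p hp).sum_signedPow_nonneg_of_isDownset hp
      (fun y => (hw y).le) hL (congrArg (· ∩ L) hpU)) ((Set.Finite.mem_toFinset _).2 hx)
  rw [Set.Finite.mem_toFinset] at hu
  refine ⟨u, hu, ?_⟩
  calc w x * (g v - f x) ≤ w x * (g x - f x) :=
        mul_le_mul_of_nonneg_left (sub_le_sub_right (hge x hx.1) _) (hw x).le
    _ = -(w x * (f x - g x)) := by ring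
    _ ≤ w u * (f u - g u) := hxu
    _ ≤ w u * (f u - g v) :=
        mul_le_mul_of_nonneg_left (sub_le_sub_left (hge u hu.1) _) (hw u).le

lemma isSaddle_of_mapClusterPt (hw : ∀ v, 0 < w v) {ρ : ℝ → V → ℝ}
    (hρ : ∀ p, 1 < p → IsLpRegression G p f w (ρ p)) (hcluster : MapClusterPt g atTop ρ) :
    IsSaddle G f w g :=
  ⟨isLowerSaddle_of_mapClusterPt hw hρ hcluster,
    isLowerSaddle_of_mapClusterPt hw (fun p hp => (hρ p hp).reverse)
      (hcluster.continuousAt_comp continuous_neg.continuousAt)⟩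

lemma eventually_mem_errorBox (hw : ∀ v, 0 < w v) {ρ : ℝ → V → ℝ}
    (hρ : ∀ p, 1 < p → IsLpRegression G p f w (ρ p)) : ∀ᶠ p in atTop, ρ p ∈ errorBox f w := by
  filter_upwards [eventually_gt_atTop 1] with p hp
  exact (hρ p hp).mem_errorBox hp.le hw

lemma exists_forall_isLpRegression (G : Digraph V) (f : V → ℝ) (hw : ∀ v, 0 < w v) :
    ∃ ρ : ℝ → V → ℝ, ∀ p, 1 < p → IsLpRegression G p f w (ρ p) := by
  choose! ρ hρ using fun (p : ℝ) (hp : 1 < p) => exists_isLpRegression G hp.le f hw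
  exact ⟨ρ, hρ⟩

lemma exists_isSaddle {V : Type*} [Finite V] (G : Digraph V) (f : V → ℝ) {w : V → ℝ}
    (hw : ∀ v, 0 < w v) : ∃ g, IsSaddle G f w g := by
  cases nonempty_fintype V
  obtain ⟨ρ, hρ⟩ := exists_forall_isLpRegression G f hw
  obtain ⟨g, -, hg⟩ := (isCompact_errorBox f w).exists_mapClusterPt
    (tendsto_principal.2 (eventually_mem_errorBox hw hρ))
  exact ⟨g, isSaddle_of_mapClusterPt hw hρ hg⟩

theorem isStrictUpInf_iff_isSaddle (hw : ∀ v, 0 < w v) :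
    IsStrictUpInf G f w g ↔ IsSaddle G f w g := by
  constructor
  · rintro ⟨ρ, hρ, hlim⟩
    exact isSaddle_of_mapClusterPt hw hρ hlim.mapClusterPt
  · intro hg
    obtain ⟨ρ, hρ⟩ := exists_forall_isLpRegression G f hw
    exact ⟨ρ, hρ, (isCompact_errorBox f w).tendsto_nhds_of_unique_mapClusterPt
      (eventually_mem_errorBox hw hρ)
      fun s _ hs => (isSaddle_of_mapClusterPt hw hρ hs).eq hw hg⟩

lemma IsStrictUpInf.isLexInf (hw : ∀ v, 0 < w v) (hg : IsStrictUpInf G f w g) :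
    IsLexInf G f w g := by
  rw [isStrictUpInf_iff_isSaddle hw] at hg
  exact ⟨hg.1.isotonic, fun _ hh hne => hg.lexLT hw hh hne⟩

end StrictRegression

section WeightedMeans

variable {V : Type*} {f w : V → ℝ} {S : Finset V} {c : ℝ}

lemma isWMean_iff_isLpRegression_top (hS : S.Nonempty) {p x : ℝ} :
    IsWMean p f w S x ↔
      IsLpRegression (⊤ : Digraph S) p (fun v => f v) (fun v => w v) fun _ => x := by
  have := hS.to_subtype
  have herr : ∀ y, lpError p (fun v : S => f v) (fun v => w v) Finset.univ (fun _ => y) =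
      lpError p f w S fun _ => y := fun y =>
    Finset.sum_coe_sort S fun v => (w v * |f v - y|) ^ p
  simp only [IsWMean, IsLpRegression, isotonic_top_iff, forall_exists_index,
    forall_eq_apply_imp_iff, herr]
  exact (and_iff_right ⟨x, rfl⟩).symm

lemma isWMeanUpInf_iff_isStrictUpInf_top (hS : S.Nonempty) :
    IsWMeanUpInf f w S c ↔
      IsStrictUpInf (⊤ : Digraph S) (fun v => f v) (fun v => w v) fun _ => c := by
  have := hS.to_subtype
  constructor
  · rintro ⟨m, hm, hlim⟩
    exact ⟨fun p _ => m p, fun p hp => (isWMean_iff_isLpRegression_top hS).1 (hm p hp),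
      tendsto_pi_nhds.2 fun _ => hlim⟩
  · rintro ⟨ρ, hρ, hlim⟩
    obtain ⟨v⟩ := hS.to_subtype
    refine ⟨fun p => ρ p v, fun p hp => (isWMean_iff_isLpRegression_top hS).2 ?_,
      tendsto_pi_nhds.1 hlim v⟩
    have hconst : ρ p = fun _ => ρ p v := by
      obtain ⟨x, hx⟩ := isotonic_top_iff.1 (hρ p hp).1
      simp only [hx]
    exact hconst ▸ hρ p hp

lemma IsDownset.eq_univ {L : Set V} (hL : IsDownset (⊤ : Digraph V) L) (hne : L.Nonempty) :
    L = Set.univ :=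
  let ⟨v, hv⟩ := hne
  Set.eq_univ_of_forall fun u => hL u v trivial hv

lemma isLowerSaddle_top_iff [Nonempty V] :
    IsLowerSaddle (⊤ : Digraph V) f w (fun _ => c) ↔ IsSubmean f w Set.univ c := by
  refine ⟨fun hc => ?_, fun hc v => ⟨Set.univ, trivial, fun _ _ _ _ => trivial, fun _ _ => le_rfl,
    fun L hvL hL => ?_⟩⟩
  · obtain ⟨U, hvU, hU, -, hsub⟩ := hc (Classical.arbitrary V)
    simpa [IsDownset.eq_univ hU ⟨_, hvU⟩] using
      hsub Set.univ trivial fun _ _ _ _ => trivial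
  · simpa [hL.eq_univ ⟨v, hvL⟩] using hc

lemma isSubmean_univ_subtype_iff :
    IsSubmean (fun v : S => f v) (fun v => w v) Set.univ c ↔ IsSubmean f w S c := by
  simp [IsSubmean]

theorem isWMeanUpInf_iff (hw : ∀ v ∈ S, 0 < w v) (hS : S.Nonempty) :
    IsWMeanUpInf f w S c ↔ IsSubmean f w S c ∧ IsSupermean f w S c := by
  have := hS.to_subtype
  rw [isWMeanUpInf_iff_isStrictUpInf_top hS,
    isStrictUpInf_iff_isSaddle fun v : S => hw v v.2]
  exact and_congr (isLowerSaddle_top_iff.trans isSubmean_univ_subtype_iff)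
    ((isLowerSaddle_top_iff (f := fun v : S => -f v)).trans
      (isSubmean_univ_subtype_iff (f := -f)))

end WeightedMeans

section Operators

variable {V : Type*} {G : Digraph V} {A : (V → ℝ) → (V → ℝ) → V → ℝ} {f w g h s : V → ℝ}

lemma toSimpleGraphInclusive_reverse (G : Digraph V) :
    (reverse G).toSimpleGraphInclusive = G.toSimpleGraphInclusive := by
  ext u v
  simp only [Digraph.toSimpleGraphInclusive, SimpleGraph.fromRel_adj]
  exact and_congr_right' or_comm

lemma isLevelSet_reverse_neg_iff {K : Set V} :
    IsLevelSet (reverse G) (-g) K ↔ IsLevelSet G g K := by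
  simp only [IsLevelSet, toSimpleGraphInclusive_reverse, Pi.neg_apply, neg_inj]

lemma exists_isLevelSet_mem [Finite V] (G : Digraph V) (g : V → ℝ) (x : V) :
    ∃ K, IsLevelSet G g K ∧ x ∈ K := by
  have hx : (G.toSimpleGraphInclusive.induce {x}).Connected ∧
      ∀ u ∈ ({x} : Set V), ∀ v ∈ ({x} : Set V), g u = g v :=
    ⟨.of_subsingleton, by rintro u rfl v rfl; rfl⟩
  obtain ⟨K, hxK, hK⟩ := Finite.exists_le_maximal (p := fun T : Set V =>
    (G.toSimpleGraphInclusive.induce T).Connected ∧ ∀ u ∈ T, ∀ v ∈ T, g u = g v) hx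
  exact ⟨K, hK, Set.singleton_subset_iff.1 hxK⟩

/-- The operator obtained from `A` by negating both the data and the result. It inherits the
properties of `A`, on the reversed digraph. -/
def dualOperator (A : (V → ℝ) → (V → ℝ) → V → ℝ) : (V → ℝ) → (V → ℝ) → V → ℝ :=
  fun f w => -A (-f) w

lemma IsLinfOperator.dual (hA : IsLinfOperator G A) :
    IsLinfOperator (reverse G) (dualOperator A) := fun f w hw => by
  simpa only [dualOperator, neg_neg] using (hA (-f) w hw).reverse

lemma IsMonotonic.dual (hA : IsMonotonic A) : IsMonotonic (dualOperator A) :=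
  fun w hw f g hfg => neg_le_neg (hA w hw (-g) (-f) (neg_le_neg hfg))

lemma PreservesLevelSetTrimming.dual (hA : PreservesLevelSetTrimming G A) :
    PreservesLevelSetTrimming (reverse G) (dualOperator A) := by
  intro f w hw K hK v hv
  have hmean := hA (-f) w hw K (isLevelSet_reverse_neg_iff.1 hK) v hv
  rw [isWMeanUpInf_iff (fun u _ => hw u) ⟨v, hv⟩] at hmean ⊢
  simpa only [IsSupermean, dualOperator, Pi.neg_apply, neg_neg] using hmean.symm

lemma PreservesLevelSetTrimming.exists_isSubmean [Finite V] (hA : PreservesLevelSetTrimming G A)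
    (hw : ∀ v, 0 < w v) (f : V → ℝ) (x : V) :
    ∃ K, x ∈ K ∧ (∀ y ∈ K, A f w y = A f w x) ∧ IsSubmean f w K (A f w x) := by
  obtain ⟨K, hK, hxK⟩ := exists_isLevelSet_mem G (A f w) x
  lift K to Finset V using K.toFinite
  have hmean := (isWMeanUpInf_iff (fun u _ => hw u) ⟨x, hxK⟩).1 (hA f w hw K hK x hxK)
  exact ⟨K, hxK, fun y hy => hK.prop.2 y hy x hxK, hmean.1⟩

lemma IsLinfRegression.error_le [Finite V] (hg : IsLinfRegression G f w g) (hh : Isotonic G h)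
    {E : ℝ} (hE : ∀ v, w v * |f v - h v| ≤ E) (v : V) : w v * |f v - g v| ≤ E :=
  have : Nonempty V := ⟨v⟩
  calc w v * |f v - g v|
      ≤ linfError f w g :=
        le_ciSup (f := fun x => w x * |f x - g x|) (Set.finite_range _).bddAbove v
    _ ≤ linfError f w h := hg.2 h hh
    _ ≤ E := ciSup_le hE

lemma IsDownset.isotonic_indicator_compl {L : Set V} (hL : IsDownset G L) {c : ℝ} (hc : 0 ≤ c) :
    Isotonic G (Lᶜ.indicator fun _ => c) := by
  refine isotonic_iff_adj.2 fun a b hab => ?_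
  by_cases hb : b ∈ L
  · simp [hb, hL a b hab hb]
  · rw [Set.indicator_of_mem (Set.mem_compl hb)]
    exact Set.indicator_le_self' (fun _ _ => hc) a

lemma IsLinfOperator.exists_separating_data [Finite V] (hA : IsLinfOperator G A)
    (hw : ∀ v, 0 < w v) (f : V → ℝ) {L : Set V} (hL : IsDownset G L) :
    ∃ F, f ≤ F ∧ Set.EqOn F f L ∧ ∀ a ∈ L, ∀ b ∉ L, A F w a < A F w b := by
  classical
  obtain ⟨E, hE⟩ := Finite.exists_le fun x => w x * |f x|
  obtain ⟨B₀, hB₀⟩ := Finite.exists_le fun x => |f x| + E / w x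
  obtain ⟨B, hB, hB_nonneg⟩ : ∃ B, (∀ x, |f x| + E / w x ≤ B) ∧ 0 ≤ B :=
    ⟨max B₀ 0, fun x => (hB₀ x).trans (le_max_left _ _), le_max_right _ _⟩
  have hE_nonneg : ∀ _ : V, 0 ≤ E := fun x =>
    (mul_nonneg (hw x).le (abs_nonneg _)).trans (hE x)
  have hEw : ∀ x, 0 ≤ E / w x := fun x => div_nonneg (hE_nonneg x) (hw x).le
  set F : V → ℝ := L.piecewise f fun _ => 2 * B + 1
  have herr : ∀ x, |F x - A F w x| ≤ E / w x := fun x => by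
    rw [le_div_iff₀' (hw x)]
    refine (hA F w hw).error_le (hL.isotonic_indicator_compl (c := 2 * B + 1) (by linarith))
      (fun y => ?_) x
    by_cases hy : y ∈ L
    · simpa [F, hy] using hE y
    · simpa [F, hy] using hE_nonneg y
  refine ⟨F, fun x => ?_, L.piecewise_eqOn _ _, fun a ha b hb => ?_⟩
  · by_cases hx : x ∈ L
    · simp [F, hx]
    · simp only [F, hx, not_false_eq_true, Set.piecewise_eq_of_notMem]
      linarith [hB x, hEw x, le_abs_self (f x)]
  · have hlow : A F w a ≤ B := by
      have herr_a := (abs_le.1 (herr a)).1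
      simp only [F, ha, Set.piecewise_eq_of_mem] at herr_a
      linarith [hB a, le_abs_self (f a)]
    have hhigh : B < A F w b := by
      have herr_b := (abs_le.1 (herr b)).2
      simp only [F, hb, not_false_eq_true, Set.piecewise_eq_of_notMem] at herr_b
      linarith [hB b, abs_nonneg (f b)]
    exact hlow.trans_lt hhigh

lemma IsLinfOperator.le_of_isUpperSaddle [Finite V] (hA : IsLinfOperator G A)
    (hmono : IsMonotonic A) (htrim : PreservesLevelSetTrimming G A) (hw : ∀ v, 0 < w v)
    (hs : IsUpperSaddle G f w s) : A f w ≤ s := by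
  intro v
  obtain ⟨L, hvL, hL, -, hsuper⟩ := hs v
  obtain ⟨F, hfF, hFf, hsep⟩ := hA.exists_separating_data hw f hL
  have hsub : IsSubmean F w ({x | A F w v ≤ A F w x} ∩ L) (A F w v) := by
    refine isSubmean_of_forall_exists_subset fun x hx => ?_
    obtain ⟨K, hxK, hK, hmean⟩ := htrim.exists_isSubmean hw F x
    refine ⟨K, fun y hy => ⟨hx.1.trans (hK y hy).ge, ?_⟩, hxK,
      hmean.of_le (fun u => (hw u).le) hx.1⟩
    by_contra hyL
    exact (hsep x hx.2 y hyL).ne' (hK y hy)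
  have hsub_f := hsub.congr (hFf.mono Set.inter_subset_right)
  have hsuper_f : IsSupermean f w ({x | A F w v ≤ A F w x} ∩ L) (s v) := by
    rw [Set.inter_comm]
    exact hsuper _ (le_refl (A F w v)) ((hA F w hw).1.isUpset_ge _)
  exact (hmono w hw f F hfF v).trans
    (hsub_f.le_of_isSupermean hsuper_f hw le_rfl ⟨v, le_refl (A F w v), hvL⟩)

lemma IsLinfOperator.eq_of_isSaddle [Finite V] (hA : IsLinfOperator G A)
    (hmono : IsMonotonic A) (htrim : PreservesLevelSetTrimming G A) (hw : ∀ v, 0 < w v)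
    (hs : IsSaddle G f w s) : A f w = s := by
  refine (hA.le_of_isUpperSaddle hmono htrim hw hs.2).antisymm ?_
  have hdual := hA.dual.le_of_isUpperSaddle hmono.dual htrim.dual hw hs.reverse.2
  rw [dualOperator, neg_neg] at hdual
  exact neg_le_neg_iff.1 hdual

theorem IsLinfOperator.isStrictUpInf [Fintype V] (hA : IsLinfOperator G A)
    (hmono : IsMonotonic A) (htrim : PreservesLevelSetTrimming G A) (hw : ∀ v, 0 < w v)
    (f : V → ℝ) : IsStrictUpInf G f w (A f w) := by
  obtain ⟨s, hs⟩ := exists_isSaddle G f hw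
  rw [isStrictUpInf_iff_isSaddle hw, hA.eq_of_isSaddle hmono htrim hw hs]
  exact hs

theorem isMonotonic_of_forall_isStrictUpInf [Fintype V]
    (hA : ∀ f w : V → ℝ, (∀ v, 0 < w v) → IsStrictUpInf G f w (A f w)) : IsMonotonic A :=
  fun w hw f g hfg =>
    ((isStrictUpInf_iff_isSaddle hw).1 (hA f w hw)).1.le_of_isUpperSaddle hw hfg
      ((isStrictUpInf_iff_isSaddle hw).1 (hA g w hw)).2

theorem preservesLevelSetTrimming_of_forall_isStrictUpInf [Fintype V]
    (hA : ∀ f w : V → ℝ, (∀ v, 0 < w v) → IsStrictUpInf G f w (A f w)) :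
    PreservesLevelSetTrimming G A := by
  intro f w hw K hK v hv
  have hsaddle := (isStrictUpInf_iff_isSaddle hw).1 (hA f w hw)
  exact (isWMeanUpInf_iff (fun u _ => hw u) ⟨v, hv⟩).2 ⟨hsaddle.1.isSubmean_levelSet hK hv,
    hsaddle.2.isSubmean_levelSet (isLevelSet_reverse_neg_iff.2 hK) hv⟩

end Operators

end IsoReg

theorem mainTheorem1_general {V : Type*} [Fintype V] (G : Digraph V)
    (A : (V → ℝ) → (V → ℝ) → V → ℝ) (hA : IsoReg.IsLinfOperator G A) :
    ((IsoReg.IsMonotonic A ∧ IsoReg.PreservesLevelSetTrimming G A) ↔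
      ∀ f w : V → ℝ, (∀ v, 0 < w v) → IsoReg.IsStrictUpInf G f w (A f w)) ∧
    ((IsoReg.IsMonotonic A ∧ IsoReg.PreservesLevelSetTrimming G A) →
      ∀ f w : V → ℝ, (∀ v, 0 < w v) → IsoReg.IsLexInf G f w (A f w)) := by
  refine ⟨⟨fun ⟨hmono, htrim⟩ f w hw => hA.isStrictUpInf hmono htrim hw f, fun hstrict => ?_⟩,
    fun ⟨hmono, htrim⟩ f w hw => (hA.isStrictUpInf hmono htrim hw f).isLexInf hw⟩
  exact ⟨IsoReg.isMonotonic_of_forall_isStrictUpInf hstrict,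
    IsoReg.preservesLevelSetTrimming_of_forall_isStrictUpInf hstrict⟩

/-- An `L_∞` isotonic regression operator on a finite dag is monotonic and preserves level set
trimming iff it always produces the strict `L_∞` isotonic regression; and then it always produces
the `lex_∞` isotonic regression. -/
theorem mainTheorem1 {V : Type*} [Fintype V] (G : Digraph V) (hG : IsoReg.Acyclic G)
    (A : (V → ℝ) → (V → ℝ) → V → ℝ) (hA : IsoReg.IsLinfOperator G A) :
    ((IsoReg.IsMonotonic A ∧ IsoReg.PreservesLevelSetTrimming G A) ↔
      ∀ f w : V → ℝ, (∀ v, 0 < w v) → IsoReg.IsStrictUpInf G f w (A f w)) ∧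
    ((IsoReg.IsMonotonic A ∧ IsoReg.PreservesLevelSetTrimming G A) →
      ∀ f w : V → ℝ, (∀ v, 0 < w v) → IsoReg.IsLexInf G f w (A f w)) :=
  mainTheorem1_general G A hA
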